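/- Let $e\ge 1$ be an integer with $3\mid 2e+1$, let $q=2^{2e+1}$, and let $\mathbb F$ be a field of order $q$ with automorphism $\theta\colon x\mapsto x^{2^{e+1}}$. Let $\mathcal O$ be the Suzuki–Tits ovoid in $\mathrm{PG}(3,\mathbb F)$, i.e. the set consisting of the point $U=(0:1:0:0)$ and all points $(1:z:x:y)$ with $x,y,z\in\mathbb F$ and $z=xy+x^{\theta+2}+y^{\theta}$, where $x^{\theta+2}=x^{\theta}x^{2}$. Let $G=\mathrm{Sz}(q)$ be the group of all projectivities of $\mathrm{PG}(3,\mathbb F)$ (elements of $\mathrm{PGL}(4,\mathbb F)$) that preserve $\mathcal O$. A triality of $G$ is an outer (that is, non-inner) automorphism of $G$ of order $3$. Let $\tau$ be a triality of $G$. Then there is exactly one permutation of $\mathcal O$, again denoted by $\tau$, such that $\tau(\gamma)$ acts on $\mathcal O$ as $\tau\circ\gamma\circ\tau^{-1}$ for every $\gamma\in G$. Let $P\in\mathcal O$ be a point with $\tau(P)\neq P$, and let $A$ be the set of involutions of $G$ that fix $P$. Then $\rho\,\tau(\rho)$ has odd order for every $\rho\in A$, and for any two distinct $\rho,\rho'\in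 A$ the elements $\rho\,\tau(\rho)$ and $\rho'\,\tau(\rho')$ are not conjugate in $G$. -/

import Mathlib

open scoped LinearAlgebra.Projectivization MatrixGroups Pointwise

namespace SuzukiTriality

/-- The point `U = (0 : 1 : 0 : 0)` of the projective space `PG(3, F)`. -/
noncomputable def pointU (F : Type*) [Field F] : ℙ F (Fin 4 → F) :=
  Projectivization.mk F ![0, 1, 0, 0] (fun h => one_ne_zero (congrFun h 1))

/-- The point `(1 : z : x : y)` of `PG(3, F)`, i.e. the point outside the plane `X₀ = 0` whose
affine coordinates are `x = X₂ / X₀`, `y = X₃ / X₀`, `z = X₁ / X₀`. -/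
noncomputable def affinePoint {F : Type*} [Field F] (x y z : F) : ℙ F (Fin 4 → F) :=
  Projectivization.mk F ![1, z, x, y] (fun h => one_ne_zero (congrFun h 0))

/-- The Suzuki-Tits ovoid over a field `F` of order `2 ^ (2 * e + 1)`: the point `U` together with
all affine points such that `z = x y + x ^ (θ + 2) + y ^ θ`, where `θ` is the field automorphism
`x ↦ x ^ (2 ^ (e + 1))`. -/
def ovoid (F : Type*) [Field F] (e : ℕ) : Set (ℙ F (Fin 4 → F)) :=
  {p | p = pointU F ∨
    ∃ x y z : F, p = affinePoint x y z ∧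
      z = x * y + x ^ (2 ^ (e + 1)) * x ^ 2 + y ^ (2 ^ (e + 1))}

/-- The Suzuki group `Sz(q)`, `q = 2 ^ (2 * e + 1)`: the group of all projectivities of `PG(3, F)`
that leave the ovoid invariant. -/
abbrev Sz (F : Type*) [Field F] (e : ℕ) : Subgroup PGL(4, F) :=
  MulAction.stabilizer PGL(4, F) (ovoid F e)

/-- A triality of a group `G`: an automorphism of order three that is outer (not inner). -/
def IsTriality {G : Type*} [Group G] (τ : MulAut G) : Prop :=
  orderOf τ = 3 ∧ τ ∉ (MulAut.conj : G →* MulAut G).range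

/-- The permutation `t` of the `G`-set `Ω` induces the automorphism `τ` of `G` by conjugation:
`τ γ` acts on `Ω` as `t ∘ γ ∘ t⁻¹`, for all `γ` in `G`. -/
def Induces {G Ω : Type*} [Group G] [MulAction G Ω] (t : Equiv.Perm Ω) (τ : MulAut G) : Prop :=
  ∀ (γ : G) (X : Ω), τ γ • X = t (γ • t.symm X)

/-- The set of involutions (elements of order two) of `G` that fix the point `P`. -/
def involutionsFixing (G : Type*) {Ω : Type*} [Group G] [MulAction G Ω] (P : Ω) : Set G :=
  {ρ | orderOf ρ = 2 ∧ ρ • P = P}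

end SuzukiTriality

/-! The involutions fixing a point P form, together with 1, a copy of (F, +), and each involution
fixes exactly one point of the ovoid. An automorphism therefore permutes the points by following the
fixed points of involutions, which gives the permutation t and its uniqueness. If ρ τ(ρ) had even
order, the central involution of the dihedral group ⟨ρ, τ(ρ)⟩ would fix both P and t P, which are
distinct.

For non-conjugacy, 2-transitivity moves P, t P to U, O. Write α for the involutions at U and w for
the swap of U and O. The torus acts on α(F) through all scalars of Fˣ, so τ becomes a ↦ k σ(a) with
σ a field endomorphism (`exists_semilinear`), and ρ τ(ρ) is conjugate to α(a) · w α(k σ(a)) w⁻¹. Its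
representative of determinant 1 has trace θ(k a σ(a)), and this trace is a conjugacy invariant
(`trace_eq_of_mk_eq`). So conjugate products give c σ(c) = 1 for c = a / b. Since F has odd degree
over its prime field, c = 1 (`eq_one_of_mul_ringHom_eq_one`).

`RootData` isolates what this needs. To verify it for the ovoid, the main point is that a
projectivity of the ovoid fixing U and O lies in the torus (`exists_eq_torusMatrix`). -/

namespace SuzukiTriality

/-- A group `G` acting on `Ω` together with a family `α` of elements, parametrised by a field, that
behaves like the centre of the root group of a Suzuki group at the point `U`. -/
structure RootData (F G Ω : Type*) [Field F] [Group G] [MulAction G Ω] where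
  U : Ω
  O : Ω
  α : F → G
  w : G
  U_ne_O : U ≠ O
  w_smul_U : w • U = O
  α_add : ∀ s t, α (s + t) = α s * α t
  α_injective : Function.Injective α
  α_smul_U : ∀ t, α t • U = U
  eq_U_of_α_smul : ∀ t P, t ≠ 0 → α t • P = P → P = U
  exists_eq_α : ∀ g : G, g * g = 1 → g • U = U → ∃ t, g = α t
  exists_conj_α : ∀ g : G, g • U = U → ∃ μ, ∀ t, g * α t * g⁻¹ = α (μ * t)
  exists_conj_eq : ∀ μ, μ ≠ 0 → ∃ g : G, g • U = U ∧ ∀ t, g * α t * g⁻¹ = α (μ * t)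
  two_transitive : ∀ P R : Ω, P ≠ R → ∃ g : G, g • P = U ∧ g • R = O
  mul_eq_mul_of_isConj : ∀ a b a' b',
    IsConj (α a * (w * α b * w⁻¹)) (α a' * (w * α b' * w⁻¹)) → a * b = a' * b'
  exists_fixed : ∀ g : G, g * g = 1 → ∃ P : Ω, g • P = P

/-! ### The abstract argument: fixed points of involutions, products of two involutions,
semilinearity. -/

namespace RootData

variable {F G Ω : Type*} [Field F] [Group G] [MulAction G Ω]

theorem orderOf_eq_two_iff {g : G} : orderOf g = 2 ↔ g * g = 1 ∧ g ≠ 1 := by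
  rw [orderOf_eq_prime_iff, pow_two]

theorem orderOf_map_two {τ : MulAut G} {ρ : G} (h : orderOf ρ = 2) : orderOf (τ ρ) = 2 := by
  rw [MulEquiv.orderOf_eq, h]

theorem α_zero (D : RootData F G Ω) : D.α 0 = 1 := by
  have h := D.α_add 0 0
  rw [add_zero] at h
  exact left_eq_mul.mp h

theorem α_mul_self (D : RootData F G Ω) [CharP F 2] (t : F) : D.α t * D.α t = 1 := by
  rw [← D.α_add, CharTwo.add_self_eq_zero, D.α_zero]

theorem exists_smul_eq_U (D : RootData F G Ω) (P : Ω) : ∃ g : G, g • P = D.U := by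
  by_cases h : P = D.U
  · exact ⟨1, by rw [one_smul, h]⟩
  · obtain ⟨g, hg, -⟩ := D.two_transitive P D.U h
    exact ⟨g, hg⟩

theorem exists_conj_eq_α (D : RootData F G Ω) {ρ g : G} {P : Ω} (hg : g • P = D.U) (hρ : ρ * ρ = 1)
    (hP : ρ • P = P) : ∃ t, g * ρ * g⁻¹ = D.α t := by
  refine D.exists_eq_α _ ?_ ?_
  · calc g * ρ * g⁻¹ * (g * ρ * g⁻¹) = g * (ρ * ρ) * g⁻¹ := by group
      _ = 1 := by rw [hρ]; group
  · rw [mul_smul, mul_smul, ← hg, inv_smul_smul, hP]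

theorem eq_of_fixed (D : RootData F G Ω) {ρ : G} (hρ : orderOf ρ = 2) {P R : Ω} (hP : ρ • P = P)
    (hR : ρ • R = R) :
    R = P := by
  obtain ⟨h2, h1⟩ := orderOf_eq_two_iff.mp hρ
  obtain ⟨g, hg⟩ := D.exists_smul_eq_U P
  obtain ⟨t, ht⟩ := D.exists_conj_eq_α hg h2 hP
  have ht0 : t ≠ 0 := by
    rintro rfl
    rw [D.α_zero, conj_eq_one_iff] at ht
    exact h1 ht
  have := D.eq_U_of_α_smul t (g • R) ht0 (by
    rw [← ht, mul_smul, mul_smul, inv_smul_smul, hR])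
  rw [← hg] at this
  exact smul_left_cancel g this

theorem commute_of_fixed (D : RootData F G Ω) {ρ ρ' : G} (hρ : orderOf ρ = 2) (hρ' : orderOf ρ' = 2)
    {P : Ω}
    (hP : ρ • P = P) (hP' : ρ' • P = P) : Commute ρ ρ' := by
  obtain ⟨g, hg⟩ := D.exists_smul_eq_U P
  obtain ⟨t, ht⟩ := D.exists_conj_eq_α hg (orderOf_eq_two_iff.mp hρ).1 hP
  obtain ⟨t', ht'⟩ := D.exists_conj_eq_α hg (orderOf_eq_two_iff.mp hρ').1 hP'
  have : Commute (g * ρ * g⁻¹) (g * ρ' * g⁻¹) := by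
    rw [ht, ht', Commute, SemiconjBy, ← D.α_add, ← D.α_add, add_comm]
  exact (Commute.conj_iff g).mp this

theorem fixed_of_commute (D : RootData F G Ω) {ρ c : G} (hρ : orderOf ρ = 2) (h : Commute ρ c)
    {P : Ω}
    (hP : ρ • P = P) : c • P = P :=
  D.eq_of_fixed hρ hP (by rw [← mul_smul, h.eq, mul_smul, hP])

theorem exists_involution_fixing (D : RootData F G Ω) [CharP F 2] (P : Ω) : ∃ ρ : G, orderOf ρ = 2 ∧
    ρ • P = P := by
  obtain ⟨g, hg⟩ := D.exists_smul_eq_U P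
  refine ⟨g⁻¹ * D.α 1 * g, orderOf_eq_two_iff.mpr ⟨?_, ?_⟩, ?_⟩
  · calc g⁻¹ * D.α 1 * g * (g⁻¹ * D.α 1 * g) = g⁻¹ * (D.α 1 * D.α 1) * g := by group
      _ = 1 := by rw [D.α_mul_self]; group
  · intro h
    have h1 : D.α 1 = D.α 0 := by
      rw [D.α_zero]
      calc D.α 1 = g * (g⁻¹ * D.α 1 * g) * g⁻¹ := by group
        _ = 1 := by rw [h]; group
    exact one_ne_zero (D.α_injective h1)
  · rw [mul_smul, mul_smul, hg, D.α_smul_U, ← hg, inv_smul_smul]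

/-- All involutions at P commute, so the images under τ of all of them fix the unique fixed point of
the image of any one of them. -/
theorem exists_fixed_map (D : RootData F G Ω) [CharP F 2] (τ : MulAut G) (P : Ω) :
    ∃ R : Ω, ∀ ρ : G, orderOf ρ = 2 → ρ • P = P → τ ρ • R = R := by
  obtain ⟨ρ, hρ, hP⟩ := D.exists_involution_fixing P
  obtain ⟨R, hR⟩ := D.exists_fixed (τ ρ) (orderOf_eq_two_iff.mp (orderOf_map_two hρ)).1
  exact ⟨R, fun ρ' hρ' hP' => D.fixed_of_commute (orderOf_map_two hρ)
    ((D.commute_of_fixed hρ hρ' hP hP').map τ) hR⟩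

theorem exists_inducing_perm (D : RootData F G Ω) [CharP F 2] (τ : MulAut G) :
    ∃ t : Equiv.Perm Ω, Induces t τ := by
  choose f hf using fun P => D.exists_fixed_map τ P
  choose f' hf' using fun P => D.exists_fixed_map τ⁻¹ P
  -- Both points are fixed by the involution τ(γ ρ γ⁻¹), hence coincide.
  have key : ∀ γ P, f (γ • P) = τ γ • f P := by
    intro γ P
    obtain ⟨ρ, hρ, hP⟩ := D.exists_involution_fixing P
    have h1 := hf (γ • P) (γ * ρ * γ⁻¹) (by
      rw [← MulAut.conj_apply, MulEquiv.orderOf_eq, hρ])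
      (by rw [mul_smul, mul_smul, inv_smul_smul, hP])
    have h2 := hf P ρ hρ hP
    rw [map_mul, map_mul, map_inv] at h1
    refine D.eq_of_fixed (orderOf_map_two (τ := MulAut.conj (τ γ)) (orderOf_map_two hρ)) ?_ h1
    rw [MulAut.conj_apply, mul_smul, mul_smul, inv_smul_smul, h2]
  have left : ∀ P, f' (f P) = P := by
    intro P
    obtain ⟨ρ, hρ, hP⟩ := D.exists_involution_fixing P
    have h := hf' (f P) (τ ρ) (orderOf_map_two hρ) (hf P ρ hρ hP)
    rw [MulAut.inv_apply_self] at h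
    exact D.eq_of_fixed hρ hP h
  have right : ∀ P, f (f' P) = P := by
    intro P
    obtain ⟨ρ, hρ, hP⟩ := D.exists_involution_fixing P
    have h := hf (f' P) (τ⁻¹ ρ) (orderOf_map_two hρ) (hf' P ρ hρ hP)
    rw [MulAut.apply_inv_self] at h
    exact D.eq_of_fixed hρ hP h
  refine ⟨⟨f, f', left, right⟩, fun γ X => ?_⟩
  change τ γ • X = f (γ • f' X)
  rw [key, right]

theorem map_smul_fixed {t : Equiv.Perm Ω} {τ : MulAut G} (h : Induces t τ) {γ : G} {P : Ω}
    (hP : γ • P = P) : τ γ • t P = t P := by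
  rw [h, t.symm_apply_apply, hP]

theorem existsUnique_inducing_perm (D : RootData F G Ω) [CharP F 2] (τ : MulAut G) :
    ∃! t : Equiv.Perm Ω, Induces t τ := by
  obtain ⟨t, ht⟩ := D.exists_inducing_perm τ
  refine ⟨t, ht, fun t' ht' => Equiv.ext fun P => ?_⟩
  obtain ⟨ρ, hρ, hP⟩ := D.exists_involution_fixing P
  exact D.eq_of_fixed (orderOf_map_two hρ) (map_smul_fixed ht hP) (map_smul_fixed ht' hP)

theorem odd_orderOf_mul (D : RootData F G Ω) [Finite G] {ρ ρ' : G} (hρ : orderOf ρ = 2)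
    (hρ' : orderOf ρ' = 2)
    {P P' : Ω} (hP : ρ • P = P) (hP' : ρ' • P' = P') (hne : P' ≠ P) :
    Odd (orderOf (ρ * ρ')) := by
  by_contra hodd
  rw [Nat.not_odd_iff_even] at hodd
  obtain ⟨m, hm⟩ := hodd
  have hpos := orderOf_pos (ρ * ρ')
  have hc : orderOf ((ρ * ρ') ^ m) = 2 := by
    rw [orderOf_pow_of_dvd (by omega) ⟨2, by omega⟩, hm, ← two_mul, Nat.mul_div_cancel _ (by omega)]
  obtain ⟨hc2, -⟩ := orderOf_eq_two_iff.mp hc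
  have h2 := (orderOf_eq_two_iff.mp hρ).1
  have h2' := (orderOf_eq_two_iff.mp hρ').1
  have hi : ρ⁻¹ = ρ := inv_eq_of_mul_eq_one_left h2
  have hi' : ρ'⁻¹ = ρ' := inv_eq_of_mul_eq_one_left h2'
  -- ρ inverts ρ ρ', and the power of order 2 is its own inverse, so ρ centralises it.
  have hconj : ρ * (ρ * ρ') ^ m * ρ⁻¹ = (ρ * ρ') ^ m := by
    rw [← conj_pow]
    have : ρ * (ρ * ρ') * ρ⁻¹ = (ρ * ρ')⁻¹ := by
      rw [mul_inv_rev, hi, hi', ← mul_assoc, h2, one_mul]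
    rw [this, inv_pow]
    exact inv_eq_of_mul_eq_one_left hc2
  have hcomm : Commute ρ ((ρ * ρ') ^ m) := mul_inv_eq_iff_eq_mul.mp hconj
  have hcomm' : Commute ρ' ((ρ * ρ') ^ m) := by
    have h : Commute (ρ * (ρ * ρ')) ((ρ * ρ') ^ m) := hcomm.mul_left (Commute.self_pow _ _)
    rwa [← mul_assoc, h2, one_mul] at h
  exact hne (D.eq_of_fixed hc (D.fixed_of_commute hρ hcomm hP)
    (D.fixed_of_commute hρ' hcomm' hP'))

/-- ψ normalises the stabiliser of U, which acts on α(F) by scalars, every nonzero scalar occurring.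
The induced additive map f thus satisfies f(c a) = μ(c) f(a), so f / f(1) is multiplicative. -/
theorem exists_semilinear (D : RootData F G Ω) [CharP F 2] (ψ : MulAut G)
    (hψ : ∀ g : G, g • D.U = D.U → ψ g • D.U = D.U) :
    ∃ (k : F) (σ : F →+* F), k ≠ 0 ∧ ∀ a, ψ (D.α a) = D.α (k * σ a) := by
  have h : ∀ a, ∃ b, ψ (D.α a) = D.α b := fun a =>
    D.exists_eq_α _ (by rw [← map_mul, D.α_mul_self, map_one]) (hψ _ (D.α_smul_U a))
  choose f hf using h
  have hadd : ∀ a b, f (a + b) = f a + f b := fun a b => D.α_injective (by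
    rw [← hf, D.α_add, D.α_add, map_mul, hf, hf])
  have hzero : f 0 = 0 := by simpa using hadd 0 0
  have hk : f 1 ≠ 0 := by
    intro h0
    have h1 := hf 1
    rw [h0, ← hzero, ← hf] at h1
    exact one_ne_zero (D.α_injective (ψ.injective h1))
  have hmul : ∀ c a, f (c * a) * f 1 = f c * f a := by
    intro c a
    by_cases hc : c = 0
    · rw [hc, zero_mul, hzero, zero_mul, zero_mul]
    obtain ⟨g, hgU, hg⟩ := D.exists_conj_eq c hc
    obtain ⟨μ, hμ⟩ := D.exists_conj_α (ψ g) (hψ g hgU)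
    have key : ∀ a, f (c * a) = μ * f a := fun a => D.α_injective (by
      rw [← hf, ← hg, ← hμ, map_mul, map_mul, map_inv, hf])
    have h1 := key 1
    rw [mul_one] at h1
    rw [key, h1]
    ring
  refine ⟨f 1, RingHom.mk' ⟨⟨fun a => (f 1)⁻¹ * f a, inv_mul_cancel₀ hk⟩, fun a b => ?_⟩
    fun a b => ?_, hk, fun a => ?_⟩
  · change (f 1)⁻¹ * f (a * b) = (f 1)⁻¹ * f a * ((f 1)⁻¹ * f b)
    field_simp
    rw [mul_comm, hmul]
  · change (f 1)⁻¹ * f (a + b) = (f 1)⁻¹ * f a + (f 1)⁻¹ * f b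
    rw [hadd, mul_add]
  · change _ = D.α (f 1 * ((f 1)⁻¹ * f a))
    rw [mul_inv_cancel_left₀ hk, hf]

theorem eq_of_isConj (D : RootData F G Ω) [CharP F 2]
    (hF : ∀ (σ : F →+* F) (a : F), a * σ a = 1 → a = 1)
    {τ : MulAut G} {t : Equiv.Perm Ω} (ht : Induces t τ) {P : Ω} (hP : t P ≠ P) {ρ ρ' : G}
    (hρ : orderOf ρ = 2) (hρP : ρ • P = P) (hρ' : orderOf ρ' = 2) (hρP' : ρ' • P = P)
    (h : IsConj (ρ * τ ρ) (ρ' * τ ρ')) : ρ = ρ' := by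
  obtain ⟨g, hgP, hgO⟩ := D.two_transitive P (t P) hP.symm
  -- ψ is τ transported by g (P to U, t P to O) and then by w⁻¹ (O back to U), so that it preserves
  -- the stabiliser of U.
  set ψ : MulAut G := MulAut.conj (D.w⁻¹ * g) * τ * MulAut.conj g⁻¹ with hψ
  have hU : ∀ x : G, x • D.U = D.U → ψ x • D.U = D.U := by
    intro x hx
    have h1 : τ (g⁻¹ * x * g) • t P = t P := by
      apply map_smul_fixed ht
      rw [mul_smul, mul_smul, hgP, hx, ← hgP, inv_smul_smul]
    have h2 : (D.w⁻¹ * g) • t P = D.U := by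
      rw [mul_smul, hgO, ← D.w_smul_U, inv_smul_smul]
    rw [hψ, MulAut.mul_apply, MulAut.mul_apply, MulAut.conj_apply, MulAut.conj_apply, inv_inv,
      mul_smul, mul_smul, ← h2, inv_smul_smul, h1]
  obtain ⟨k, σ, hk, hσ⟩ := D.exists_semilinear ψ hU
  have main : ∀ ρ : G, orderOf ρ = 2 → ρ • P = P → ∃ a, a ≠ 0 ∧ g * ρ * g⁻¹ = D.α a ∧
      g * (ρ * τ ρ) * g⁻¹ = D.α a * (D.w * D.α (k * σ a) * D.w⁻¹) := by
    intro ρ hρ hρP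
    obtain ⟨h2, h1⟩ := orderOf_eq_two_iff.mp hρ
    obtain ⟨a, ha⟩ := D.exists_conj_eq_α hgP h2 hρP
    refine ⟨a, ?_, ha, ?_⟩
    · rintro rfl
      rw [D.α_zero, conj_eq_one_iff] at ha
      exact h1 ha
    · have h3 : g⁻¹ * (g * ρ * g⁻¹) * g = ρ := by group
      rw [← hσ, ← ha, hψ, MulAut.mul_apply, MulAut.mul_apply, MulAut.conj_apply,
        MulAut.conj_apply, inv_inv, h3]
      group
  obtain ⟨a, ha0, ha, hap⟩ := main ρ hρ hρP
  obtain ⟨b, hb0, hb, hbp⟩ := main ρ' hρ' hρP'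
  have hconj : IsConj (g * (ρ * τ ρ) * g⁻¹) (g * (ρ' * τ ρ') * g⁻¹) :=
    ((isConj_iff.mpr ⟨g, rfl⟩).symm.trans h).trans (isConj_iff.mpr ⟨g, rfl⟩)
  rw [hap, hbp] at hconj
  have hab := D.mul_eq_mul_of_isConj _ _ _ _ hconj
  have hσb : σ b ≠ 0 := (map_ne_zero σ).mpr hb0
  have : a / b = 1 := hF σ (a / b) (by
    rw [map_div₀]
    field_simp
    have h4 : k * (a * σ a) = k * (b * σ b) := by linear_combination hab
    exact mul_left_cancel₀ hk h4)
  rw [div_eq_one_iff_eq hb0] at this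
  have h5 : g * ρ * g⁻¹ = g * ρ' * g⁻¹ := by rw [ha, hb, this]
  exact mul_left_cancel (mul_right_cancel h5)

end RootData

/-- From σ(a) = a⁻¹ follows σ²(a) = a. The Galois group over the prime field has odd order n, so
σ(a) = a, whence a² = 1 and a = 1 in characteristic 2. -/
theorem eq_one_of_mul_ringHom_eq_one {F : Type*} [Field F] [Finite F] {n : ℕ}
    (hF : Nat.card F = 2 ^ n) (hn : Odd n) [CharP F 2] (σ : F →+* F) (a : F)
    (h : a * σ a = 1) : a = 1 := by
  have ha : a ≠ 0 := left_ne_zero_of_mul_eq_one h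
  have hσ : σ a = a⁻¹ := eq_inv_of_mul_eq_one_right h
  have hσσ : σ (σ a) = a := by rw [hσ, map_inv₀, hσ, inv_inv]
  let _ : Algebra (ZMod 2) F := ZMod.algebra F 2
  have hfin : Module.finrank (ZMod 2) F = n := by
    have h1 := Module.natCard_eq_pow_finrank (K := ZMod 2) (V := F)
    rw [hF, Nat.card_zmod] at h1
    exact (Nat.pow_right_injective le_rfl h1).symm
  let e : F ≃ₐ[ZMod 2] F := AlgEquiv.ofBijective
    (AlgHom.mk σ fun r => RingHom.congr_fun (RingHom.ext_zmod (σ.comp (algebraMap _ _)) _) r)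
    ((Finite.injective_iff_bijective).mp σ.injective)
  have he : ∀ x, e x = σ x := fun _ => rfl
  have hcard : e ^ n = 1 := by
    rw [← hfin, ← IsGalois.card_aut_eq_finrank (ZMod 2) F]
    exact pow_card_eq_one'
  have heven : ∀ k, (e ^ (2 * k)) a = a := by
    intro k
    induction k with
    | zero => rfl
    | succ k ih =>
      rw [mul_add, pow_add, mul_one, AlgEquiv.mul_apply, pow_two, AlgEquiv.mul_apply, he, he, hσσ,
        ih]
  obtain ⟨k, hk⟩ := hn
  have h1 : σ a = a := by
    have h2 : (e ^ (2 * k + 1)) a = σ a := by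
      rw [pow_succ', AlgEquiv.mul_apply, heven, he]
    rw [← h2, ← hk, hcard, AlgEquiv.one_apply]
  rw [h1] at h
  have h3 : (a - 1) ^ 2 = 0 := by
    linear_combination h + (1 - a) * CharTwo.two_eq_zero (R := F)
  exact sub_eq_zero.mp (pow_eq_zero_iff two_ne_zero |>.mp h3)

/-! ### The Tits form: rigidity under linear maps, and the generating matrices. -/

section Tits

variable {F : Type*} [Field F] (θ : F →+* F)

/-- The coordinate `z = x y + x ^ (θ + 2) + y ^ θ` of a point of the ovoid. -/
def ovoidCoord (x y : F) : F := x * y + θ x * x ^ 2 + θ y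

theorem exists_map_ne_sq [CharP F 2] (hθ : ∀ x, θ (θ x) = x ^ 2) (hF : ∃ l : F, l ≠ 0 ∧ l ≠ 1) :
    ∃ v, θ v ≠ v ^ 2 := by
  by_contra! h
  obtain ⟨l, h0, h1⟩ := hF
  have h2 := hθ l
  rw [h l, map_pow, h l] at h2
  have h3 : l ^ 2 * ((l - 1) * (l + 1)) = 0 := by linear_combination h2
  have h4 : l + 1 = l - 1 := by rw [CharTwo.sub_eq_add]
  rw [h4] at h3
  simp [h0, sub_ne_zero.mpr h1] at h3

theorem exists_map_ne_self (hθ : ∀ x, θ (θ x) = x ^ 2) (hF : ∃ l : F, l ≠ 0 ∧ l ≠ 1) :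
    ∃ v, θ v ≠ v := by
  by_contra! h
  obtain ⟨l, h0, h1⟩ := hF
  have h2 := hθ l
  rw [h l, h l] at h2
  have h3 : l * (l - 1) = 0 := by linear_combination -h2
  simp [h0, sub_ne_zero.mpr h1] at h3

/-- In characteristic 2 all one-variable terms are additive except θ(x) x², whose additivity defect
at (v, 1) is θ(v) + v². Choosing v with nonzero defect isolates the coefficients of these terms;
comparing scaling behaviour separates x, x² and θ(x). -/
theorem linear_map_preserving_ovoidCoord [CharP F 2] (hθ : ∀ x, θ (θ x) = x ^ 2)
    (hF : ∃ l : F, l ≠ 0 ∧ l ≠ 1) {m r s a b c d : F} (hm : m ≠ 0)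
    (h : ∀ x y, m * ovoidCoord θ x y + r * x + s * y =
      ovoidCoord θ (a * x + b * y) (c * x + d * y)) :
    b = 0 ∧ c = 0 ∧ r = 0 ∧ s = 0 ∧ d = a * θ a ∧ m = a ^ 2 * θ a ∧ a ≠ 0 := by
  have h2 : (2 : F) = 0 := CharTwo.two_eq_zero
  obtain ⟨v, hv⟩ := exists_map_ne_sq θ hθ hF
  obtain ⟨u, hu⟩ := exists_map_ne_self θ hθ hF
  obtain ⟨l, hl0, hl1⟩ := hF
  have hv' : θ v + v ^ 2 ≠ 0 := by rwa [Ne, CharTwo.add_eq_zero]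
  have hu' : θ u - u ≠ 0 := sub_ne_zero.mpr hu
  have hl : l ^ 2 - l ≠ 0 := by
    rw [show l ^ 2 - l = l * (l - 1) by ring]
    exact mul_ne_zero hl0 (sub_ne_zero.mpr hl1)
  simp only [ovoidCoord, map_add, map_mul] at h
  have hb : b = 0 := by
    have e1 := h 0 (v + 1)
    have e2 := h 0 v
    have e3 := h 0 1
    simp only [map_add, map_one, map_zero, mul_zero, zero_add, mul_one, zero_mul, add_zero] at e1 e2 e3
    have e4 : θ b * b ^ 2 * (θ v + v ^ 2) = 0 := by grind
    simpa [hv'] using e4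
  subst hb
  simp only [map_zero, zero_mul, add_zero] at h
  have hs : s = 0 := by
    have e1 := h 0 u
    have e2 := h 0 1
    simp only [map_one, map_zero, mul_zero, zero_add, mul_one, zero_mul, add_zero] at e1 e2
    have e4 : s * (θ u - u) = 0 := by grind
    simpa [hu'] using e4
  subst hs
  have hmd : m = θ d := by
    have e2 := h 0 1
    simpa using e2
  have hma : m = a ^ 2 * θ a := by
    have e1 := h (v + 1) 0
    have e2 := h v 0
    have e3 := h 1 0
    simp only [map_add, map_one, map_zero, mul_zero, zero_add, mul_one, add_zero] at e1 e2 e3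
    have e4 : (m - a ^ 2 * θ a) * (θ v + v ^ 2) = 0 := by grind
    simpa [hv', sub_eq_zero] using e4
  have ha : a ≠ 0 := by
    rintro rfl
    simp [hm] at hma
  have had : m = a * d := by
    have e1 := h 1 1
    have e2 := h 1 0
    simp only [map_one, map_zero, mul_zero, zero_add, mul_one, add_zero] at e1 e2
    grind
  have hd : d = a * θ a := by
    apply mul_left_cancel₀ ha
    rw [← had, hma]
    ring
  have hadd : ∀ x, r * x + a * c * x ^ 2 + θ c * θ x = 0 := by
    intro x
    have e1 := h x 0
    simp only [map_zero, mul_zero, zero_add, add_zero] at e1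
    grind
  have hc : c = 0 := by
    -- Substituting y x for x and subtracting y times the relation at x eliminates r.
    have e : ∀ x y, a * c * (y ^ 2 - y) * x ^ 2 + θ c * (θ y - y) * θ x = 0 := by
      intro x y
      have e1 := hadd (y * x)
      have e2 := hadd x
      rw [map_mul] at e1
      linear_combination e1 - y * e2
    have e1 := e v l
    have e2 := e 1 l
    simp only [map_one, mul_one, one_pow] at e1 e2
    have e3 : a * c * (l ^ 2 - l) * (θ v + v ^ 2) = 0 := by grind
    simpa [hv', hl, ha] using e3
  subst hc
  have hr : r = 0 := by simpa using hadd 1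
  exact ⟨rfl, rfl, hr, rfl, hd, hma, ha⟩

/-- The root element `(x, y) ↦ (x + s, y + s ^ θ x + t)` of the Suzuki group. -/
noncomputable def rootMatrix (s t : F) : GL (Fin 4) F :=
  Matrix.GeneralLinearGroup.mkOfDetNeZero
    !![1, 0, 0, 0; s * t + θ s * s ^ 2 + θ t, 1, t + θ s * s, s; s, 0, 1, 0; t, 0, θ s, 1]
    (by simp [Matrix.det_succ_row_zero, Fin.sum_univ_succ, Fin.succAbove])

/-- The torus element `(x, y) ↦ (κ x, κ ^ (θ + 1) y)` of the Suzuki group. -/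
noncomputable def torusMatrix (κ : Fˣ) : GL (Fin 4) F :=
  Matrix.GeneralLinearGroup.mkOfDetNeZero
    !![1, 0, 0, 0; 0, κ ^ 2 * θ κ, 0, 0; 0, 0, (κ : F), 0; 0, 0, 0, κ * θ κ]
    (by simp [Matrix.det_succ_row_zero, Fin.sum_univ_succ, Fin.succAbove])

/-- The element of the Suzuki group that interchanges the points `(0 : 1 : 0 : 0)` and
`(1 : 0 : 0 : 0)`. -/
noncomputable def swapMatrix (F : Type*) [Field F] : GL (Fin 4) F :=
  Matrix.GeneralLinearGroup.mkOfDetNeZero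
    !![0, 1, 0, 0; 1, 0, 0, 0; 0, 0, 0, 1; 0, 0, 1, 0]
    (by simp [Matrix.det_succ_row_zero, Fin.sum_univ_succ, Fin.succAbove])

theorem rootMatrix_mul_zero_left (s t t' : F) :
    rootMatrix θ s t * rootMatrix θ 0 t' = rootMatrix θ s (t + t') := by
  ext i j
  fin_cases i <;> fin_cases j <;>
    simp [rootMatrix, Matrix.GeneralLinearGroup.mkOfDetNeZero, Matrix.mul_apply,
      Fin.sum_univ_succ] <;> ring

theorem rootMatrix_mul_zero_right (s t t' : F) :
    rootMatrix θ 0 t' * rootMatrix θ s t = rootMatrix θ s (t + t') := by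
  ext i j
  fin_cases i <;> fin_cases j <;>
    simp [rootMatrix, Matrix.GeneralLinearGroup.mkOfDetNeZero, Matrix.mul_apply,
      Fin.sum_univ_succ] <;> ring

theorem torusMatrix_mul_rootMatrix (hθ : ∀ x, θ (θ x) = x ^ 2) (κ : Fˣ) (t : F) :
    torusMatrix θ κ * rootMatrix θ 0 t = rootMatrix θ 0 (κ * θ κ * t) * torusMatrix θ κ := by
  ext i j
  fin_cases i <;> fin_cases j <;>
    simp [rootMatrix, torusMatrix, Matrix.GeneralLinearGroup.mkOfDetNeZero, Matrix.mul_apply,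
      Fin.sum_univ_succ, hθ] <;> (try left) <;> ring

theorem torusMatrix_one : torusMatrix θ 1 = 1 := by
  ext i j
  fin_cases i <;> fin_cases j <;>
    simp [torusMatrix, Matrix.GeneralLinearGroup.mkOfDetNeZero]

theorem rootMatrix_det (s t : F) : (rootMatrix θ s t : Matrix (Fin 4) (Fin 4) F).det = 1 := by
  simp [rootMatrix, Matrix.GeneralLinearGroup.mkOfDetNeZero, Matrix.det_succ_row_zero,
    Fin.sum_univ_succ, Fin.succAbove]

theorem swapMatrix_mul_self : swapMatrix F * swapMatrix F = 1 := by
  ext i j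
  fin_cases i <;> fin_cases j <;>
    simp [swapMatrix, Matrix.GeneralLinearGroup.mkOfDetNeZero, Matrix.mul_apply,
      Fin.sum_univ_succ]

/-- The diagonal contributes 4 and the mixed terms 2ab, both zero in characteristic 2; only θ(a)
θ(b) survives. -/
theorem trace_root_mul_conj_root [CharP F 2] (a b : F) :
    (rootMatrix θ 0 a * (swapMatrix F * rootMatrix θ 0 b * swapMatrix F) :
      Matrix (Fin 4) (Fin 4) F).trace = θ (a * b) := by
  have h2 : (2 : F) = 0 := CharTwo.two_eq_zero
  simp [rootMatrix, swapMatrix, Matrix.GeneralLinearGroup.mkOfDetNeZero, Matrix.trace,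
    Fin.sum_univ_succ]
  grind

end Tits

/-! ### Action of the matrices on the ovoid, and the stabiliser of two points. -/

section TitsGroup

variable {F : Type*} [Field F] (θ : F →+* F)

/-- The Tits ovoid attached to an endomorphism `θ`. -/
def titsOvoid : Set (ℙ F (Fin 4 → F)) :=
  {p | p = pointU F ∨ ∃ x y : F, p = affinePoint x y (ovoidCoord θ x y)}

theorem mk_smul_eq_iff (M : GL (Fin 4) F) {v w : Fin 4 → F} (hv : v ≠ 0) (hw : w ≠ 0) :
    (Matrix.ProjGenLinGroup.mk M : PGL(4, F)) • Projectivization.mk F v hv =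
      Projectivization.mk F w hw ↔
      ∃ c : F, c ≠ 0 ∧ c • w = Matrix.mulVec (M : Matrix (Fin 4) (Fin 4) F) v := by
  rw [Projectivization.PGL.mk_smul_mk, Projectivization.mk_eq_mk_iff]
  exact ⟨fun ⟨a, ha⟩ => ⟨a, a.ne_zero, ha⟩, fun ⟨c, hc, h⟩ => ⟨Units.mk0 c hc, h⟩⟩

theorem affinePoint_ne_pointU (x y z : F) : affinePoint x y z ≠ pointU F := by
  rw [affinePoint, pointU, Ne, Projectivization.mk_eq_mk_iff']
  rintro ⟨a, ha⟩
  simpa using congrFun ha 0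

theorem affinePoint_injective {x y z x' y' z' : F}
    (h : affinePoint x y z = affinePoint x' y' z') : x = x' ∧ y = y' ∧ z = z' := by
  rw [affinePoint, affinePoint, Projectivization.mk_eq_mk_iff'] at h
  obtain ⟨a, ha⟩ := h
  have h0 : a = 1 := by simpa using congrFun ha 0
  subst h0
  have h1 := congrFun ha 1
  have h2 := congrFun ha 2
  have h3 := congrFun ha 3
  simp at h1 h2 h3
  exact ⟨h2.symm, h3.symm, h1.symm⟩

theorem rootMatrix_smul_pointU (s t : F) :
    (Matrix.ProjGenLinGroup.mk (rootMatrix θ s t) : PGL(4, F)) • pointU F = pointU F := by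
  refine (mk_smul_eq_iff _ _ _).mpr ⟨1, one_ne_zero, ?_⟩
  ext i
  fin_cases i <;>
    simp [rootMatrix, Matrix.GeneralLinearGroup.mkOfDetNeZero, Matrix.mulVec, dotProduct,
      Fin.sum_univ_succ]

theorem torusMatrix_smul_pointU (κ : Fˣ) :
    (Matrix.ProjGenLinGroup.mk (torusMatrix θ κ) : PGL(4, F)) • pointU F = pointU F := by
  refine (mk_smul_eq_iff _ _ _).mpr ⟨κ ^ 2 * θ κ, by simp, ?_⟩
  ext i
  fin_cases i <;>
    simp [torusMatrix, Matrix.GeneralLinearGroup.mkOfDetNeZero, Matrix.mulVec, dotProduct,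
      Fin.sum_univ_succ]

theorem rootMatrix_smul_affinePoint [CharP F 2] (hθ : ∀ x, θ (θ x) = x ^ 2) (s t x y : F) :
    (Matrix.ProjGenLinGroup.mk (rootMatrix θ s t) : PGL(4, F)) •
      affinePoint x y (ovoidCoord θ x y) =
      affinePoint (x + s) (y + t + θ s * x) (ovoidCoord θ (x + s) (y + t + θ s * x)) := by
  have h2 : (2 : F) = 0 := CharTwo.two_eq_zero
  refine (mk_smul_eq_iff _ _ _).mpr ⟨1, one_ne_zero, ?_⟩
  ext i
  fin_cases i <;>
    simp [rootMatrix, Matrix.GeneralLinearGroup.mkOfDetNeZero, Matrix.mulVec, dotProduct,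
      Fin.sum_univ_succ, ovoidCoord, hθ] <;> grind

theorem torusMatrix_smul_affinePoint (hθ : ∀ x, θ (θ x) = x ^ 2) (κ : Fˣ) (x y : F) :
    (Matrix.ProjGenLinGroup.mk (torusMatrix θ κ) : PGL(4, F)) •
      affinePoint x y (ovoidCoord θ x y) =
      affinePoint (κ * x) (κ * θ κ * y) (ovoidCoord θ (κ * x) (κ * θ κ * y)) := by
  refine (mk_smul_eq_iff _ _ _).mpr ⟨1, one_ne_zero, ?_⟩
  ext i
  fin_cases i <;>
    simp [torusMatrix, Matrix.GeneralLinearGroup.mkOfDetNeZero, Matrix.mulVec, dotProduct,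
      Fin.sum_univ_succ, ovoidCoord, hθ]
  ring

theorem swapMatrix_smul_pointU :
    (Matrix.ProjGenLinGroup.mk (swapMatrix F) : PGL(4, F)) • pointU F =
      affinePoint 0 0 (ovoidCoord θ 0 0) := by
  refine (mk_smul_eq_iff _ _ _).mpr ⟨1, one_ne_zero, ?_⟩
  ext i
  fin_cases i <;>
    simp [swapMatrix, Matrix.GeneralLinearGroup.mkOfDetNeZero, Matrix.mulVec, dotProduct,
      Fin.sum_univ_succ, ovoidCoord]

theorem swapMatrix_smul_affinePoint_zero :
    (Matrix.ProjGenLinGroup.mk (swapMatrix F) : PGL(4, F)) •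
      affinePoint 0 0 (ovoidCoord θ 0 0) = pointU F := by
  refine (mk_smul_eq_iff _ _ _).mpr ⟨1, one_ne_zero, ?_⟩
  ext i
  fin_cases i <;>
    simp [swapMatrix, Matrix.GeneralLinearGroup.mkOfDetNeZero, Matrix.mulVec, dotProduct,
      Fin.sum_univ_succ, ovoidCoord]

/-- With denominators cleared, this says that (y/z, x/z) has third coordinate 1/z, so the swap
preserves the ovoid. It also shows that z = 0 forces y = 0. -/
theorem mul_ovoidCoord [CharP F 2] (hθ : ∀ x, θ (θ x) = x ^ 2) (x y : F) :
    ovoidCoord θ x y * θ (ovoidCoord θ x y) =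
      x * y * θ (ovoidCoord θ x y) + θ y * y ^ 2 + θ x * ovoidCoord θ x y ^ 2 := by
  have h2 : (2 : F) = 0 := CharTwo.two_eq_zero
  simp only [ovoidCoord, map_add, map_mul, map_pow, hθ]
  grind

theorem ovoidCoord_eq_zero [CharP F 2] (hθ : ∀ x, θ (θ x) = x ^ 2) {x y : F}
    (h : ovoidCoord θ x y = 0) : x = 0 ∧ y = 0 := by
  have h1 := mul_ovoidCoord θ hθ x y
  rw [h] at h1
  have hy : y = 0 := by simpa using h1
  subst hy
  refine ⟨?_, rfl⟩
  simpa [ovoidCoord] using h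

theorem swapMatrix_smul_affinePoint [CharP F 2] (hθ : ∀ x, θ (θ x) = x ^ 2) {x y : F}
    (h : ovoidCoord θ x y ≠ 0) :
    (Matrix.ProjGenLinGroup.mk (swapMatrix F) : PGL(4, F)) •
      affinePoint x y (ovoidCoord θ x y) =
      affinePoint (y / ovoidCoord θ x y) (x / ovoidCoord θ x y)
        (ovoidCoord θ (y / ovoidCoord θ x y) (x / ovoidCoord θ x y)) := by
  have hz := mul_ovoidCoord θ hθ x y
  set z := ovoidCoord θ x y with hzdef
  have hθz : θ z ≠ 0 := (map_ne_zero θ).mpr h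
  have key : z * ovoidCoord θ (y / z) (x / z) = 1 := by
    rw [ovoidCoord, map_div₀, map_div₀]
    field_simp
    linear_combination -hz
  refine (mk_smul_eq_iff _ _ _).mpr ⟨z, h, ?_⟩
  ext i
  fin_cases i <;>
    simp [swapMatrix, Matrix.GeneralLinearGroup.mkOfDetNeZero, Matrix.mulVec, dotProduct,
      Fin.sum_univ_succ, key] <;> field_simp

theorem mem_stabilizer_of_smul_mem [Finite F] {g : PGL(4, F)}
    (hU : g • pointU F ∈ titsOvoid θ)
    (hA : ∀ x y, g • affinePoint x y (ovoidCoord θ x y) ∈ titsOvoid θ) :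
    g ∈ MulAction.stabilizer PGL(4, F) (titsOvoid θ) := by
  have hfin : (titsOvoid θ).Finite := by
    refine Set.Finite.subset ((Set.finite_singleton (pointU F)).union
      (Set.finite_range fun p : F × F => affinePoint p.1 p.2 (ovoidCoord θ p.1 p.2))) ?_
    rintro p (rfl | ⟨x, y, rfl⟩)
    · exact Or.inl rfl
    · exact Or.inr ⟨(x, y), rfl⟩
  rw [MulAction.mem_stabilizer_set' hfin]
  rintro p (rfl | ⟨x, y, rfl⟩)
  · exact hU
  · exact hA x y

theorem rootMatrix_mem [Finite F] [CharP F 2] (hθ : ∀ x, θ (θ x) = x ^ 2) (s t : F) :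
    Matrix.ProjGenLinGroup.mk (rootMatrix θ s t) ∈
      MulAction.stabilizer PGL(4, F) (titsOvoid θ) :=
  mem_stabilizer_of_smul_mem θ (Or.inl (rootMatrix_smul_pointU θ s t))
    fun x y => Or.inr ⟨_, _, rootMatrix_smul_affinePoint θ hθ s t x y⟩

theorem torusMatrix_mem [Finite F] (hθ : ∀ x, θ (θ x) = x ^ 2) (κ : Fˣ) :
    Matrix.ProjGenLinGroup.mk (torusMatrix θ κ) ∈
      MulAction.stabilizer PGL(4, F) (titsOvoid θ) :=
  mem_stabilizer_of_smul_mem θ (Or.inl (torusMatrix_smul_pointU θ κ))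
    fun x y => Or.inr ⟨_, _, torusMatrix_smul_affinePoint θ hθ κ x y⟩

theorem swapMatrix_mem [Finite F] [CharP F 2] (hθ : ∀ x, θ (θ x) = x ^ 2) :
    Matrix.ProjGenLinGroup.mk (swapMatrix F) ∈
      MulAction.stabilizer PGL(4, F) (titsOvoid θ) := by
  refine mem_stabilizer_of_smul_mem θ (Or.inr ⟨0, 0, swapMatrix_smul_pointU θ⟩) fun x y => ?_
  by_cases h : ovoidCoord θ x y = 0
  · obtain ⟨rfl, rfl⟩ := ovoidCoord_eq_zero θ hθ h
    exact Or.inl (swapMatrix_smul_affinePoint_zero θ)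
  · exact Or.inr ⟨_, _, swapMatrix_smul_affinePoint θ hθ h⟩

theorem exists_eq_torusMatrix [CharP F 2] (hθ : ∀ x, θ (θ x) = x ^ 2)
    (hF : ∃ l : F, l ≠ 0 ∧ l ≠ 1) {g : PGL(4, F)}
    (hg : g ∈ MulAction.stabilizer PGL(4, F) (titsOvoid θ)) (hU : g • pointU F = pointU F)
    (hO : g • affinePoint 0 0 (ovoidCoord θ 0 0) = affinePoint 0 0 (ovoidCoord θ 0 0)) :
    ∃ κ : Fˣ, g = Matrix.ProjGenLinGroup.mk (torusMatrix θ κ) := by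
  obtain ⟨M, rfl⟩ := Matrix.ProjGenLinGroup.mk_surjective g
  have hA : ∀ x y, ∃ x' y', (Matrix.ProjGenLinGroup.mk M : PGL(4, F)) •
      affinePoint x y (ovoidCoord θ x y) = affinePoint x' y' (ovoidCoord θ x' y') := by
    intro x y
    rcases (MulAction.mem_stabilizer_set.mp hg (affinePoint x y (ovoidCoord θ x y))).mpr
      (Or.inr ⟨x, y, rfl⟩) with h | ⟨x', y', h⟩
    · rw [← hU] at h
      exact absurd (smul_left_cancel _ h) (affinePoint_ne_pointU _ _ _)
    · exact ⟨x', y', h⟩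
  obtain ⟨m, hm, hU⟩ := (mk_smul_eq_iff _ _ _).mp hU
  obtain ⟨n, hn, hO⟩ := (mk_smul_eq_iff _ _ _).mp hO
  have hA' : ∀ x y, ∃ x' y', ∃ c : F, c ≠ 0 ∧ c • ![1, ovoidCoord θ x' y', x', y'] =
      Matrix.mulVec (M : Matrix (Fin 4) (Fin 4) F) ![1, ovoidCoord θ x y, x, y] := by
    intro x y
    obtain ⟨x', y', h⟩ := hA x y
    obtain ⟨c, hc⟩ := (mk_smul_eq_iff _ _ _).mp h
    exact ⟨x', y', c, hc⟩
  have hU0 := congrFun hU 0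
  have hU1 := congrFun hU 1
  have hU2 := congrFun hU 2
  have hU3 := congrFun hU 3
  have hO0 := congrFun hO 0
  have hO1 := congrFun hO 1
  have hO2 := congrFun hO 2
  have hO3 := congrFun hO 3
  simp [Matrix.mulVec, dotProduct, Fin.sum_univ_succ, ovoidCoord] at hU0 hU1 hU2 hU3 hO0 hO1 hO2 hO3
  simp only [funext_iff, Fin.forall_fin_succ] at hA'
  simp [Matrix.mulVec, dotProduct, Fin.sum_univ_succ] at hA'
  -- A nonzero entry here would send the affine point with x = n / M₀₂, y = 0 into the plane X₀ = 0,
  -- as n + n = 0.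
  have hM02 : M.1 0 2 = 0 := by
    by_contra h
    refine (hA' (n / M.1 0 2) 0).1 ?_
    rw [← hU0, ← hO0, mul_div_cancel₀ _ h]
    linear_combination n * CharTwo.two_eq_zero (R := F)
  have hM03 : M.1 0 3 = 0 := by
    by_contra h
    refine (hA' 0 (n / M.1 0 3)).1 ?_
    rw [← hU0, ← hO0, mul_div_cancel₀ _ h]
    linear_combination n * CharTwo.two_eq_zero (R := F)
  -- The first row is now (n, 0, 0, 0), so after division by n the map is linear in the affine
  -- coordinates and the rigidity lemma applies.
  have hlin : ∀ x y, M.1 1 1 / n * ovoidCoord θ x y + M.1 1 2 / n * x + M.1 1 3 / n * y =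
      ovoidCoord θ (M.1 2 2 / n * x + M.1 2 3 / n * y) (M.1 3 2 / n * x + M.1 3 3 / n * y) := by
    intro x y
    obtain ⟨-, x', y', h1, h2, h3⟩ := hA' x y
    simp only [hM02, hM03, ← hU0, ← hO0, ← hO1, ← hO2, ← hO3, ← hU2, ← hU3, zero_mul, add_zero,
      zero_add] at h1 h2 h3
    have hx : M.1 2 2 / n * x + M.1 2 3 / n * y = x' := by
      field_simp
      linear_combination -h2
    have hy : M.1 3 2 / n * x + M.1 3 3 / n * y = y' := by
      field_simp
      linear_combination -h3
    rw [hx, hy]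
    field_simp
    linear_combination -h1
  have hm' : M.1 1 1 / n ≠ 0 := by
    rw [← hU1]
    exact div_ne_zero hm hn
  obtain ⟨hb, hc, hr, hs, hd, hmm, ha⟩ := linear_map_preserving_ovoidCoord θ hθ hF hm' hlin
  refine ⟨Units.mk0 _ ha, Eq.symm (Matrix.ProjGenLinGroup.mk_eq_mk_iff.mpr ⟨Units.mk0 n hn, ?_⟩)⟩
  rw [div_eq_iff hn, map_div₀] at hd hmm
  simp only [div_eq_zero_iff, hn, or_false] at hb hc hr hs
  ext i j
  fin_cases i <;> fin_cases j <;>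
    simp [torusMatrix, Matrix.GeneralLinearGroup.mkOfDetNeZero, Matrix.mul_apply,
      Fin.sum_univ_succ]
  all_goals first | assumption | (symm; assumption) | exact div_mul_cancel₀ _ hn

end TitsGroup

/-- Conjugacy in PGL leaves a scalar u; determinants give u⁴ = 1, that is (u - 1)⁴ = 0 in
characteristic 2, so u = 1. -/
theorem trace_eq_of_mk_eq {F : Type*} [Field F] [CharP F 2] {A B : GL (Fin 4) F}
    (hA : (A : Matrix (Fin 4) (Fin 4) F).det = 1) (hB : (B : Matrix (Fin 4) (Fin 4) F).det = 1)
    (h : IsConj (Matrix.ProjGenLinGroup.mk A) (Matrix.ProjGenLinGroup.mk B)) :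
    (A : Matrix (Fin 4) (Fin 4) F).trace = (B : Matrix (Fin 4) (Fin 4) F).trace := by
  obtain ⟨c, hc⟩ := isConj_iff.mp h
  obtain ⟨C, rfl⟩ := Matrix.ProjGenLinGroup.mk_surjective c
  rw [← map_inv, ← map_mul, ← map_mul, Matrix.ProjGenLinGroup.mk_eq_mk_iff] at hc
  obtain ⟨u, hu⟩ := hc
  have hu' : (u : F) • ((C : Matrix (Fin 4) (Fin 4) F) * A * (C⁻¹ : GL (Fin 4) F)) = B := by
    rw [← hu, Units.val_mul, Units.val_mul, Units.val_mul, Matrix.GeneralLinearGroup.coe_scalar,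
      Matrix.scalar_apply, ← Matrix.smul_one_eq_diagonal, Matrix.mul_smul, mul_one]
  have hdet := congrArg Matrix.det hu'
  rw [Matrix.det_smul, Matrix.det_units_conj, hA, hB, Fintype.card_fin, mul_one] at hdet
  have h1 : ((u : F) - 1) ^ 4 = 0 := by
    linear_combination hdet - (2 * (u : F) ^ 3 - 3 * u ^ 2 + 2 * u - 1) *
      CharTwo.two_eq_zero (R := F)
  have hu1 : (u : F) = 1 := sub_eq_zero.mp (pow_eq_zero_iff four_ne_zero |>.mp h1)
  rw [← hu', hu1, one_smul, Matrix.trace_units_conj]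

/-! ### Group structure: the stabiliser of U, its involutions, and the root data. -/

section TitsGroup

variable {F : Type*} [Field F] (θ : F →+* F)

/-- The group of all projectivities leaving the Tits ovoid invariant. -/
abbrev titsGroup : Subgroup PGL(4, F) := MulAction.stabilizer PGL(4, F) (titsOvoid θ)

/-- The point `(0 : 1 : 0 : 0)` of the Tits ovoid. -/
noncomputable def infPoint : titsOvoid θ := ⟨pointU F, Or.inl rfl⟩

/-- The point of the Tits ovoid with affine coordinates `x` and `y`. -/
noncomputable def affPoint (x y : F) : titsOvoid θ :=
  ⟨affinePoint x y (ovoidCoord θ x y), Or.inr ⟨x, y, rfl⟩⟩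

theorem eq_infPoint_or_affPoint (P : titsOvoid θ) :
    P = infPoint θ ∨ ∃ x y, P = affPoint θ x y := by
  obtain ⟨p, rfl | ⟨x, y, rfl⟩⟩ := P
  · exact Or.inl rfl
  · exact Or.inr ⟨x, y, rfl⟩

theorem affPoint_ne_infPoint (x y : F) : affPoint θ x y ≠ infPoint θ :=
  fun h => affinePoint_ne_pointU _ _ _ (congrArg Subtype.val h)

theorem affPoint_injective {x y x' y' : F} (h : affPoint θ x y = affPoint θ x' y') :
    x = x' ∧ y = y' := by
  obtain ⟨h1, h2, -⟩ := affinePoint_injective (congrArg Subtype.val h)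
  exact ⟨h1, h2⟩

/-- The points of the Tits ovoid are parametrised by the affine plane and a point at infinity. -/
noncomputable def ovoidEquiv : Option (F × F) ≃ titsOvoid θ :=
  Equiv.ofBijective (fun o => o.elim (infPoint θ) fun p => affPoint θ p.1 p.2) <| by
    constructor
    · rintro (_ | p) (_ | p') h
      · rfl
      · exact absurd h.symm (affPoint_ne_infPoint θ _ _)
      · exact absurd h (affPoint_ne_infPoint θ _ _)
      · obtain ⟨h1, h2⟩ := affPoint_injective θ h
        rw [Prod.ext h1 h2]
    · intro P
      rcases eq_infPoint_or_affPoint θ P with rfl | ⟨x, y, rfl⟩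
      · exact ⟨none, rfl⟩
      · exact ⟨some (x, y), rfl⟩

theorem even_card [Finite F] [CharP F 2] : Even (Nat.card F) := by
  have := Fintype.ofFinite F
  rw [Nat.card_eq_fintype_card, even_iff_two_dvd, ← CharP.cast_eq_zero_iff F 2]
  exact Nat.cast_card_eq_zero F

/-- The ovoid has q² + 1 points, an odd number. -/
theorem exists_fixed_point [Finite F] [CharP F 2] (g : titsGroup θ) (hg : g * g = 1) :
    ∃ P : titsOvoid θ, g • P = P := by
  have : Finite (titsOvoid θ) := Finite.of_equiv _ (ovoidEquiv θ)
  have := Fintype.ofFinite (titsOvoid θ)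
  have hcard : ¬ 2 ∣ Fintype.card (titsOvoid θ) := by
    rw [← Nat.card_eq_fintype_card, ← Nat.card_congr (ovoidEquiv θ), Finite.card_option,
      Nat.card_prod, Nat.two_dvd_ne_zero, ← Nat.odd_iff]
    exact ((even_card (F := F)).mul_left _).add_one
  refine Equiv.Perm.exists_fixed_point_of_prime (p := 2) (n := 1) hcard
    (σ := MulAction.toPerm g) ?_
  ext1 P
  rw [pow_one, pow_two, Equiv.Perm.mul_apply, MulAction.toPerm_apply, MulAction.toPerm_apply,
    ← mul_smul, hg, one_smul, Equiv.Perm.one_apply]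

variable [Finite F] {θ} (hθ : ∀ x, θ (θ x) = x ^ 2)

/-- The torus element `(x, y) ↦ (κ x, κ ^ (θ + 1) y)` as an element of the Suzuki group. -/
noncomputable def torusElement (κ : Fˣ) : titsGroup θ := ⟨_, torusMatrix_mem θ hθ κ⟩

theorem torusElement_smul_infPoint (κ : Fˣ) : torusElement hθ κ • infPoint θ = infPoint θ :=
  Subtype.ext (torusMatrix_smul_pointU θ κ)

theorem torusElement_smul_affPoint (κ : Fˣ) (x y : F) :
    torusElement hθ κ • affPoint θ x y = affPoint θ (κ * x) (κ * θ κ * y) :=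
  Subtype.ext (torusMatrix_smul_affinePoint θ hθ κ x y)

theorem torusElement_one : torusElement hθ 1 = 1 :=
  Subtype.ext ((congrArg Matrix.ProjGenLinGroup.mk (torusMatrix_one θ)).trans (map_one _))

variable [CharP F 2]

/-- The root element `(x, y) ↦ (x + s, y + s ^ θ x + t)` as an element of the Suzuki group. -/
noncomputable def rootElement (s t : F) : titsGroup θ := ⟨_, rootMatrix_mem θ hθ s t⟩

/-- The involution of the Suzuki group that interchanges `(0 : 1 : 0 : 0)` and
`(1 : 0 : 0 : 0)`. -/
noncomputable def swapElement : titsGroup θ := ⟨_, swapMatrix_mem θ hθ⟩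

theorem rootElement_smul_infPoint (s t : F) : rootElement hθ s t • infPoint θ = infPoint θ :=
  Subtype.ext (rootMatrix_smul_pointU θ s t)

theorem rootElement_smul_affPoint (s t x y : F) :
    rootElement hθ s t • affPoint θ x y = affPoint θ (x + s) (y + t + θ s * x) :=
  Subtype.ext (rootMatrix_smul_affinePoint θ hθ s t x y)

theorem swapElement_smul_infPoint : swapElement hθ • infPoint θ = affPoint θ 0 0 :=
  Subtype.ext (swapMatrix_smul_pointU θ)

theorem swapElement_smul_affPoint_zero : swapElement hθ • affPoint θ 0 0 = infPoint θ :=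
  Subtype.ext (swapMatrix_smul_affinePoint_zero θ)

theorem rootElement_mul_zero_left (s t t' : F) :
    rootElement hθ s t * rootElement hθ 0 t' = rootElement hθ s (t + t') :=
  Subtype.ext ((map_mul Matrix.ProjGenLinGroup.mk _ _).symm.trans
    (congrArg _ (rootMatrix_mul_zero_left θ s t t')))

theorem rootElement_mul_zero_right (s t t' : F) :
    rootElement hθ 0 t' * rootElement hθ s t = rootElement hθ s (t + t') :=
  Subtype.ext ((map_mul Matrix.ProjGenLinGroup.mk _ _).symm.trans
    (congrArg _ (rootMatrix_mul_zero_right θ s t t')))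

theorem torusElement_mul_rootElement (κ : Fˣ) (t : F) :
    torusElement hθ κ * rootElement hθ 0 t =
      rootElement hθ 0 (κ * θ κ * t) * torusElement hθ κ :=
  Subtype.ext ((map_mul Matrix.ProjGenLinGroup.mk _ _).symm.trans
    ((congrArg _ (torusMatrix_mul_rootMatrix θ hθ κ t)).trans (map_mul _ _ _)))

theorem swapElement_mul_self : swapElement hθ * swapElement hθ = 1 :=
  Subtype.ext ((map_mul Matrix.ProjGenLinGroup.mk _ _).symm.trans
    ((congrArg _ swapMatrix_mul_self).trans (map_one _)))

theorem rootElement_smul_affPoint_zero (x y : F) :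
    rootElement hθ x y • affPoint θ 0 0 = affPoint θ x y := by
  rw [rootElement_smul_affPoint, zero_add, zero_add, mul_zero, add_zero]

theorem exists_eq_root_mul_torus (hF : ∃ l : F, l ≠ 0 ∧ l ≠ 1) {g : titsGroup θ}
    (hg : g • infPoint θ = infPoint θ) :
    ∃ s t κ, g = rootElement hθ s t * torusElement hθ κ := by
  rcases eq_infPoint_or_affPoint θ (g • affPoint θ 0 0) with h | ⟨s, t, h⟩
  · rw [← hg] at h
    exact absurd (smul_left_cancel g h) (affPoint_ne_infPoint θ 0 0)
  · have h1 : ((rootElement hθ s t)⁻¹ * g) • infPoint θ = infPoint θ := by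
      rw [mul_smul, hg, inv_smul_eq_iff, rootElement_smul_infPoint]
    have h2 : ((rootElement hθ s t)⁻¹ * g) • affPoint θ 0 0 = affPoint θ 0 0 := by
      rw [mul_smul, h, inv_smul_eq_iff, rootElement_smul_affPoint_zero]
    obtain ⟨κ, hκ⟩ := exists_eq_torusMatrix θ hθ hF ((rootElement hθ s t)⁻¹ * g).2
      (congrArg Subtype.val h1) (congrArg Subtype.val h2)
    exact ⟨s, t, κ, inv_mul_eq_iff_eq_mul.mp (Subtype.ext hκ)⟩

theorem exists_eq_rootElement_zero (hF : ∃ l : F, l ≠ 0 ∧ l ≠ 1) {g : titsGroup θ}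
    (hg2 : g * g = 1) (hg : g • infPoint θ = infPoint θ) : ∃ t, g = rootElement hθ 0 t := by
  obtain ⟨s, t, κ, rfl⟩ := exists_eq_root_mul_torus hθ hF hg
  have h : ∀ x y, (rootElement hθ s t * torusElement hθ κ) •
      (rootElement hθ s t * torusElement hθ κ) • affPoint θ x y = affPoint θ x y := by
    intro x y
    rw [← mul_smul, hg2, one_smul]
  simp only [mul_smul, rootElement_smul_affPoint, torusElement_smul_affPoint] at h
  obtain ⟨h0, -⟩ := affPoint_injective θ (h 0 0)
  obtain ⟨h1, -⟩ := affPoint_injective θ (h 1 0)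
  -- On x the element acts as x ↦ κ x + s, and its square is the identity, so κ² = 1.
  have h2 : ((κ : F) - 1) ^ 2 = 0 := by
    linear_combination h1 - h0 + (1 - (κ : F)) * CharTwo.two_eq_zero (R := F)
  have hκ : κ = 1 := Units.ext (sub_eq_zero.mp (pow_eq_zero_iff two_ne_zero |>.mp h2))
  subst hκ
  obtain ⟨-, h3⟩ := affPoint_injective θ (h 0 0)
  simp only [Units.val_one, map_one, mul_zero, zero_add, one_mul, add_zero] at h3
  -- With κ = 1, the square shifts y at the origin by 2t + θ(s) s.
  have h4 : θ s * s = 0 := by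
    linear_combination h3 - t * CharTwo.two_eq_zero (R := F)
  have hs : s = 0 := by simpa using h4
  exact ⟨t, by rw [hs, torusElement_one, mul_one]⟩

theorem torusElement_conj (κ : Fˣ) (t : F) :
    torusElement hθ κ * rootElement hθ 0 t * (torusElement hθ κ)⁻¹ =
      rootElement hθ 0 (κ * θ κ * t) :=
  mul_inv_eq_iff_eq_mul.mpr (torusElement_mul_rootElement hθ κ t)

theorem exists_conj_rootElement (hF : ∃ l : F, l ≠ 0 ∧ l ≠ 1) {g : titsGroup θ}
    (hg : g • infPoint θ = infPoint θ) :
    ∃ μ, ∀ t, g * rootElement hθ 0 t * g⁻¹ = rootElement hθ 0 (μ * t) := by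
  obtain ⟨s, u, κ, rfl⟩ := exists_eq_root_mul_torus hθ hF hg
  refine ⟨κ * θ κ, fun t => ?_⟩
  rw [mul_inv_eq_iff_eq_mul, mul_assoc, torusElement_mul_rootElement, ← mul_assoc, ← mul_assoc,
    rootElement_mul_zero_left, rootElement_mul_zero_right]

theorem exists_torus_conj_eq (μ : F) (hμ : μ ≠ 0) :
    ∃ g : titsGroup θ, g • infPoint θ = infPoint θ ∧
      ∀ t, g * rootElement hθ 0 t * g⁻¹ = rootElement hθ 0 (μ * t) := by
  have hθμ : θ μ ≠ 0 := (map_ne_zero θ).mpr hμ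
  -- κ = θ(μ) / μ solves κ θ(κ) = μ, since θ(θ(μ)) = μ².
  refine ⟨torusElement hθ (Units.mk0 (θ μ / μ) (div_ne_zero hθμ hμ)),
    torusElement_smul_infPoint hθ _, fun t => ?_⟩
  rw [torusElement_conj, Units.val_mk0, map_div₀, hθ]
  congr 2
  field_simp

theorem exists_smul_infPoint_affPoint (hθ : ∀ x, θ (θ x) = x ^ 2) {P R : titsOvoid θ} (h : P ≠ R) :
    ∃ g : titsGroup θ, g • P = infPoint θ ∧ g • R = affPoint θ 0 0 := by
  have h1 : ∃ g : titsGroup θ, g • P = infPoint θ := by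
    rcases eq_infPoint_or_affPoint θ P with rfl | ⟨x, y, rfl⟩
    · exact ⟨1, one_smul _ _⟩
    · refine ⟨swapElement hθ * (rootElement hθ x y)⁻¹, ?_⟩
      rw [← rootElement_smul_affPoint_zero hθ x y, mul_smul, inv_smul_smul,
        swapElement_smul_affPoint_zero]
  obtain ⟨g, hg⟩ := h1
  rcases eq_infPoint_or_affPoint θ (g • R) with hR | ⟨x, y, hR⟩
  · rw [← hg] at hR
    exact absurd (smul_left_cancel g hR).symm h
  · refine ⟨(rootElement hθ x y)⁻¹ * g, ?_, ?_⟩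
    · rw [mul_smul, hg, inv_smul_eq_iff, rootElement_smul_infPoint]
    · rw [mul_smul, hR, inv_smul_eq_iff, rootElement_smul_affPoint_zero]

theorem mul_eq_mul_of_isConj_root (a b a' b' : F)
    (h : IsConj
      (rootElement hθ 0 a * (swapElement hθ * rootElement hθ 0 b * (swapElement hθ)⁻¹))
      (rootElement hθ 0 a' * (swapElement hθ * rootElement hθ 0 b' * (swapElement hθ)⁻¹))) :
    a * b = a' * b' := by
  have hw : (swapElement hθ)⁻¹ = swapElement hθ :=
    inv_eq_of_mul_eq_one_left (swapElement_mul_self hθ)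
  rw [hw] at h
  have hval : ∀ a b : F,
      (titsGroup θ).subtype (rootElement hθ 0 a *
        (swapElement hθ * rootElement hθ 0 b * swapElement hθ)) =
      Matrix.ProjGenLinGroup.mk
        (rootMatrix θ 0 a * (swapMatrix F * rootMatrix θ 0 b * swapMatrix F)) := by
    intro a b
    simp only [map_mul]
    rfl
  have hdet : ∀ a b : F, ((rootMatrix θ 0 a *
      (swapMatrix F * rootMatrix θ 0 b * swapMatrix F) : GL (Fin 4) F) :
        Matrix (Fin 4) (Fin 4) F).det = 1 := by
    intro a b
    have h1 := congrArg (fun M : GL (Fin 4) F => (M : Matrix (Fin 4) (Fin 4) F).det)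
      (swapMatrix_mul_self (F := F))
    simp only [Units.val_mul, Matrix.det_mul, Units.val_one, Matrix.det_one] at h1
    simp only [Units.val_mul, Matrix.det_mul, rootMatrix_det, mul_one, h1]
  have h2 := (titsGroup θ).subtype.map_isConj h
  rw [hval, hval] at h2
  have h3 := trace_eq_of_mk_eq (hdet a b) (hdet a' b') h2
  simp only [Units.val_mul, trace_root_mul_conj_root] at h3
  exact θ.injective h3

/-- The elations with centre `(0 : 1 : 0 : 0)` in the Suzuki group. -/
noncomputable def suzukiRootData (hF : ∃ l : F, l ≠ 0 ∧ l ≠ 1) :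
    RootData F (titsGroup θ) (titsOvoid θ) where
  U := infPoint θ
  O := affPoint θ 0 0
  α := rootElement hθ 0
  w := swapElement hθ
  U_ne_O := (affPoint_ne_infPoint θ 0 0).symm
  w_smul_U := swapElement_smul_infPoint hθ
  α_add s t := (rootElement_mul_zero_left hθ 0 s t).symm
  α_injective s t h := (affPoint_injective θ (by
    rw [← rootElement_smul_affPoint_zero hθ 0 s, ← rootElement_smul_affPoint_zero hθ 0 t, h])).2
  α_smul_U := rootElement_smul_infPoint hθ 0
  eq_U_of_α_smul t P ht h := by
    rcases eq_infPoint_or_affPoint θ P with rfl | ⟨x, y, rfl⟩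
    · rfl
    · rw [rootElement_smul_affPoint] at h
      have h1 := (affPoint_injective θ h).2
      rw [map_zero, zero_mul, add_zero, add_eq_left] at h1
      exact absurd h1 ht
  exists_eq_α _ h hU := exists_eq_rootElement_zero hθ hF h hU
  exists_conj_α _ hU := exists_conj_rootElement hθ hF hU
  exists_conj_eq := exists_torus_conj_eq hθ
  two_transitive _ _ h := exists_smul_infPoint_affPoint hθ h
  mul_eq_mul_of_isConj := mul_eq_mul_of_isConj_root hθ
  exists_fixed := exists_fixed_point θ

end TitsGroup

/-! ### Specialisation to the field of order 2^(2e+1), and the theorem. -/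

theorem ovoid_eq_titsOvoid (F : Type*) [Field F] [CharP F 2] (e : ℕ) :
    ovoid F e = titsOvoid (iterateFrobenius F 2 (e + 1)) := by
  ext p
  simp only [ovoid, titsOvoid, ovoidCoord, iterateFrobenius_def, Set.mem_ofPred_eq]
  refine or_congr Iff.rfl ⟨?_, ?_⟩
  · rintro ⟨x, y, z, h, rfl⟩
    exact ⟨x, y, h⟩
  · rintro ⟨x, y, h⟩
    exact ⟨x, y, _, h, rfl⟩

theorem exists_rootData {F : Type*} [Field F] [Finite F] [CharP F 2] {e : ℕ} (he : e ≠ 0)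
    (hF : Nat.card F = 2 ^ (2 * e + 1)) : Nonempty (RootData F (Sz F e) (ovoid F e)) := by
  -- θ² raises to the power 2^(2e+2) = 2q, and x^q = x.
  have hθ : ∀ x, iterateFrobenius F 2 (e + 1) (iterateFrobenius F 2 (e + 1) x) = x ^ 2 := by
    intro x
    have := Fintype.ofFinite F
    have h := FiniteField.pow_card x
    rw [← Nat.card_eq_fintype_card, hF] at h
    rw [iterateFrobenius_def, iterateFrobenius_def, ← pow_mul, ← pow_add,
      show e + 1 + (e + 1) = 2 * e + 1 + 1 by ring, pow_succ, pow_mul, h]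
  have hl : ∃ l : F, l ≠ 0 ∧ l ≠ 1 := by
    have := Fintype.ofFinite F
    have h4 : 2 ^ 1 < Fintype.card F := by
      rw [← Nat.card_eq_fintype_card, hF]
      exact Nat.pow_lt_pow_right one_lt_two (by omega)
    classical
    by_contra! h
    refine h4.not_ge ((Finset.card_le_card (t := {0, 1}) fun l _ => ?_).trans Finset.card_le_two)
    by_cases h0 : l = 0
    · simp [h0]
    · simp [h l h0]
  have := suzukiRootData hθ hl
  unfold Sz
  rw [ovoid_eq_titsOvoid]
  exact ⟨this⟩

end SuzukiTriality

theorem lemma3p1 {F : Type*} [Field F] [Finite F] (e : ℕ) (h3 : 3 ∣ 2 * e + 1)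
    (hF : Nat.card F = 2 ^ (2 * e + 1))
    (τ : MulAut (SuzukiTriality.Sz F e)) (hτ : SuzukiTriality.IsTriality τ) :
    (∃! t : Equiv.Perm (SuzukiTriality.ovoid F e), SuzukiTriality.Induces t τ) ∧
    ∀ t : Equiv.Perm (SuzukiTriality.ovoid F e), SuzukiTriality.Induces t τ →
      ∀ P : SuzukiTriality.ovoid F e, t P ≠ P →
        (∀ ρ ∈ SuzukiTriality.involutionsFixing (SuzukiTriality.Sz F e) P,
          Odd (orderOf (ρ * τ ρ))) ∧
        (∀ ρ ∈ SuzukiTriality.involutionsFixing (SuzukiTriality.Sz F e) P,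
          ∀ ρ' ∈ SuzukiTriality.involutionsFixing (SuzukiTriality.Sz F e) P,
            ρ ≠ ρ' → ¬ IsConj (ρ * τ ρ) (ρ' * τ ρ')) := by
  have : CharP F 2 := by
    have := Fintype.ofFinite F
    exact charP_of_card_eq_prime_pow (Nat.card_eq_fintype_card (α := F) ▸ hF)
  have : Finite PGL(4, F) := Finite.of_surjective _ Matrix.ProjGenLinGroup.mk_surjective
  -- Divisibility of 2e + 1 by 3 excludes e = 0, the field with two elements.
  obtain ⟨D⟩ := SuzukiTriality.exists_rootData (by rintro rfl; omega) hF
  refine ⟨D.existsUnique_inducing_perm τ, fun t ht P hP => ⟨?_, ?_⟩⟩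
  · rintro ρ ⟨hρ, hρP⟩
    exact D.odd_orderOf_mul hρ (SuzukiTriality.RootData.orderOf_map_two hρ) hρP
      (SuzukiTriality.RootData.map_smul_fixed ht hρP) hP
  · rintro ρ ⟨hρ, hρP⟩ ρ' ⟨hρ', hρP'⟩ hne h
    exact hne (D.eq_of_isConj (SuzukiTriality.eq_one_of_mul_ringHom_eq_one hF ⟨e, rfl⟩) ht hP
      hρ hρP hρ' hρP' h)
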